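/- Let $d\ge 1$, $\underline\alpha,\overline\alpha\in(0,2)$, $\underline c\in(0,1]$ and $\overline C\in[1,\infty)$. There are constants $c^*>0$ and $r_0>0$, depending only on $d,\underline\alpha,\underline c,\overline\alpha,\overline C$, such that the following holds. Let $\nu(dx)=\nu(x)\,dx$ be a nonzero isotropic unimodal Lévy measure on $\mathbb R^d$, that is, $\nu(\{0\})=0$, $\int_{\mathbb R^d}(|x|^2\wedge 1)\,\nu(dx)<\infty$, and the density $\nu(x)\in[0,\infty)$ is radial and radially nonincreasing on $\mathbb R^d\setminus\{0\}$. (These are the Lévy measures of the nontrivial pure-jump isotropic unimodal Lévy processes $X$.) Let $$\psi(\xi)=\int_{\mathbb R^d}\bigl(1-\cos\langle\xi,x\rangle\bigr)\,\nu(dx),\qquad \xi\in\mathbb R^d,$$ be the corresponding Lévy–Khintchine exponent (so $\mathbb E e^{i\langle\xi,X_t\rangle}=e^{-t\psi(\xi)}$). It is a radial function; write $\psi(u)=\psi(\xi)$ for $u=|\xi|$, and let $\psi^*(u)=\sup_{0\le s\le u}\psi(s)$, $u\ge 0$. Suppose that, for some $\theta\ge 0$, $\psi$ satisfies the weak lower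 scaling condition WLSC$(\underline\alpha,\theta,\underline c)$ and the weak upper scaling condition WUSC$(\overline\alpha,\theta,\overline C)$, i.e. $$\underline c\,\lambda^{\underline\alpha}\,\psi(u)\le\psi(\lambda u)\le\overline C\,\lambda^{\overline\alpha}\,\psi(u)\qquad\text{for all }\lambda\ge 1,\ u>\theta .$$ Then $$\nu(x)\ \ge\ c^*\,\frac{\psi^*(1/|x|)}{|x|^d}\qquad\text{for all } x\in\mathbb R^d \text{ with } 0<|x|<r_0/\theta,$$ where $r_0/\theta=\infty$ if $\theta=0$. -/

import Mathlib

open MeasureTheory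

/-- `ν` is a Lévy measure on `ℝ^d`: it does not charge the origin and
`∫ (|x|² ∧ 1) ν(dx) < ∞`. -/
structure IsLevyMeasure {d : ℕ} (ν : Measure (EuclideanSpace ℝ (Fin d))) : Prop where
  measure_zero : ν {0} = 0
  lintegral_lt_top : ∫⁻ x, ENNReal.ofReal (min (‖x‖ ^ 2) 1) ∂ν < ⊤

/-- `f` is a (Borel, finite, nonnegative) radial nonincreasing function on `ℝ^d ∖ {0}`;
its value at the origin is irrelevant. Taking `‖x‖ = ‖y‖` shows that `f` is radial. -/
structure IsRadialNonincreasing {d : ℕ} (f : EuclideanSpace ℝ (Fin d) → ℝ) : Prop where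
  measurable : Measurable f
  nonneg : ∀ x, x ≠ 0 → 0 ≤ f x
  le_of_norm_le : ∀ x y, x ≠ 0 → ‖x‖ ≤ ‖y‖ → f y ≤ f x

/-- `ν` is an isotropic unimodal Lévy measure, with radial nonincreasing density `f`. -/
structure IsUnimodalLevyMeasure {d : ℕ} (ν : Measure (EuclideanSpace ℝ (Fin d)))
    (f : EuclideanSpace ℝ (Fin d) → ℝ) : Prop where
  isLevyMeasure : IsLevyMeasure ν
  radial : IsRadialNonincreasing f
  eq_withDensity : ν = volume.withDensity (fun x => ENNReal.ofReal (f x))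

/-- The Lévy–Khintchine exponent `ψ(ξ) = ∫ (1 - cos ⟨ξ, x⟩) ν(dx)` of the pure-jump
symmetric Lévy process with Lévy measure `ν`. -/
noncomputable def levyExponent {d : ℕ} (ν : Measure (EuclideanSpace ℝ (Fin d)))
    (ξ : EuclideanSpace ℝ (Fin d)) : ℝ :=
  ∫ x, (1 - Real.cos (inner ℝ ξ x)) ∂ν

/-- The exponent as a function of `u = |ξ| ≥ 0`, read off at `ξ = (u, 0, …, 0)`; see
`levyExponent_eq_radialExponent` for the independence of the direction. -/
noncomputable def radialExponent {d : ℕ} [NeZero d] (ν : Measure (EuclideanSpace ℝ (Fin d)))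
    (u : ℝ) : ℝ :=
  levyExponent ν (EuclideanSpace.single (0 : Fin d) u)

/-- The maximal function `φ^*(u) = sup_{0 ≤ s ≤ u} φ(s)`. -/
noncomputable def maximalFunction (φ : ℝ → ℝ) (u : ℝ) : ℝ :=
  sSup (φ '' Set.Icc 0 u)

/-- The weak lower scaling condition `WLSC(α, θ, c)`. -/
structure WLSC (φ : ℝ → ℝ) (α θ c : ℝ) : Prop where
  threshold_nonneg : 0 ≤ θ
  const_pos : 0 < c
  const_le_one : c ≤ 1
  scaling : ∀ l t : ℝ, 1 ≤ l → θ < t → c * l ^ α * φ t ≤ φ (l * t)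

/-- The weak upper scaling condition `WUSC(α, θ, C)`. -/
structure WUSC (φ : ℝ → ℝ) (α θ C : ℝ) : Prop where
  threshold_nonneg : 0 ≤ θ
  one_le_const : 1 ≤ C
  scaling : ∀ l t : ℝ, 1 ≤ l → θ < t → φ (l * t) ≤ C * l ^ α * φ t

/-- The exponent of an isotropic unimodal Lévy measure is a radial function. -/
theorem levyExponent_eq_radialExponent {d : ℕ} [NeZero d]
    {ν : Measure (EuclideanSpace ℝ (Fin d))} {f : EuclideanSpace ℝ (Fin d) → ℝ}
    (h : IsUnimodalLevyMeasure ν f) (ξ : EuclideanSpace ℝ (Fin d)) :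
    levyExponent ν ξ = radialExponent ν ‖ξ‖ := by
  set η : EuclideanSpace ℝ (Fin d) := EuclideanSpace.single (0 : Fin d) ‖ξ‖ with hη
  have hn : ‖ξ‖ = ‖η‖ := by simp [hη]
  let A : EuclideanSpace ℝ (Fin d) ≃ₗᵢ[ℝ] EuclideanSpace ℝ (Fin d) :=
    Submodule.reflection (ℝ ∙ (ξ - η))ᗮ
  have hA : A ξ = η := Submodule.reflection_sub hn
  have hf : ∀ x, f (A x) = f x := by
    intro x
    rcases eq_or_ne x 0 with rfl | hx
    · simp
    · exact le_antisymm (h.radial.le_of_norm_le _ _ hx (A.norm_map x).ge)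
        (h.radial.le_of_norm_le _ _ (by simpa using hx) (A.norm_map x).le)
  have hmp : MeasurePreserving A ν ν := by
    refine ⟨A.continuous.measurable, ?_⟩
    ext s hs
    rw [Measure.map_apply A.continuous.measurable hs, h.eq_withDensity,
      withDensity_apply _ hs, withDensity_apply _ (A.continuous.measurable hs),
      ← (A.measurePreserving).setLIntegral_comp_preimage hs
        (h.radial.measurable.ennreal_ofReal)]
    simp only [hf]
  have key := hmp.integral_comp A.toHomeomorph.measurableEmbedding
    (fun x => 1 - Real.cos (inner ℝ η x))
  unfold radialExponent levyExponent
  rw [← hη, ← key, ← hA]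
  simp only [LinearIsometryEquiv.inner_map_map]

/-! Let `H u` be the integral of `min 1 (u‖x‖)²`. It is monotone in `u ≥ 0` and comparable to the
exponent. The bound `ψ ≤ 2H` holds for every Lévy measure; `H ≤ Mψ` with `M = d(π²/2 + 2)` uses
unimodality, through the half-space bound `measure_pi_lt_inner_le`. Scaling thus transfers to `H`.
Put `s = ‖x‖`. Since `α₂ < 2`, `H` grows more slowly than quadratically, so for large `A` the mass
outside radius `s` is at least `H(1/(As))/2`. Since `α₁ > 0`, for large `B` the mass outside radius
`ABs` is at most `H(1/(ABs)) ≤ H(1/(As))/4`. The annulus between therefore has mass at least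
`H(1/(As))/4`, while monotonicity of the density bounds this mass by `f x` times the volume of the
outer ball. Finally `H(1/(As))` dominates a multiple of `H(1/s)`, hence of `ψ*(1/s)`. -/

/-- The truncated second moment `∫ (1 ∧ |u x|²) ν(dx)` (Pruitt's function at `1 / u`). -/
noncomputable def truncatedSecondMoment {d : ℕ} (ν : Measure (EuclideanSpace ℝ (Fin d)))
    (u : ℝ) : ℝ :=
  ∫ x, min 1 ((u * ‖x‖) ^ 2) ∂ν

/-! ### Quadratic bounds for the cosine -/

section Elementary

theorem one_sub_cos_le_two_mul_min (t : ℝ) : 1 - Real.cos t ≤ 2 * min 1 (t ^ 2) := by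
  rcases le_total 1 (t ^ 2) with h | h
  · rw [min_eq_left h]; linarith [Real.neg_one_le_cos t]
  · rw [min_eq_right h]; nlinarith [Real.one_sub_sq_div_two_le_cos (x := t), sq_nonneg t]

theorem min_one_sq_le_one_sub_cos {t : ℝ} (ht : |t| ≤ Real.pi) :
    min 1 (t ^ 2) ≤ Real.pi ^ 2 / 2 * (1 - Real.cos t) := by
  have h := Real.cos_le_one_sub_mul_cos_sq ht
  refine (min_le_right _ _).trans ?_
  have hp := Real.pi_pos
  have : Real.pi ^ 2 / 2 * (2 / Real.pi ^ 2 * t ^ 2) = t ^ 2 := by field_simp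
  rw [← this]
  gcongr
  linarith

end Elementary

/-! ### Truncated second moment and tails of a Lévy measure -/

section LevyMeasure

variable {d : ℕ} {ν : Measure (EuclideanSpace ℝ (Fin d))}

theorem IsLevyMeasure.integrable_min_sq (h : IsLevyMeasure ν) (u : ℝ) :
    Integrable (fun x => min 1 ((u * ‖x‖) ^ 2)) ν := by
  have h0 : Integrable (fun x : EuclideanSpace ℝ (Fin d) => min (‖x‖ ^ 2) 1) ν := by
    refine ⟨by fun_prop, ?_⟩
    rw [hasFiniteIntegral_iff_ofReal (ae_of_all _ fun x => by positivity)]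
    exact h.lintegral_lt_top
  refine (h0.const_mul (1 + u ^ 2)).mono' (by fun_prop) (ae_of_all _ fun x => ?_)
  rw [Real.norm_of_nonneg (by positivity), mul_pow]
  have hu := sq_nonneg u
  have hx := sq_nonneg ‖x‖
  rcases le_total (‖x‖ ^ 2) 1 with hx1 | hx1
  · rw [min_eq_left hx1]; exact (min_le_right _ _).trans (by nlinarith)
  · rw [min_eq_right hx1]; exact (min_le_left _ _).trans (by nlinarith)

theorem IsLevyMeasure.integrable_one_sub_cos (h : IsLevyMeasure ν)
    (ξ : EuclideanSpace ℝ (Fin d)) :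
    Integrable (fun x => 1 - Real.cos (inner ℝ ξ x)) ν := by
  refine ((h.integrable_min_sq ‖ξ‖).const_mul 2).mono' (by fun_prop) (ae_of_all _ fun x => ?_)
  rw [Real.norm_of_nonneg (by linarith [Real.cos_le_one (inner ℝ ξ x)])]
  refine (one_sub_cos_le_two_mul_min _).trans ?_
  have : (inner ℝ ξ x) ^ 2 ≤ (‖ξ‖ * ‖x‖) ^ 2 := sq_le_sq' (neg_le_of_abs_le
    (abs_real_inner_le_norm ξ x)) (real_inner_le_norm ξ x)
  gcongr

theorem IsLevyMeasure.levyExponent_le (h : IsLevyMeasure ν) (ξ : EuclideanSpace ℝ (Fin d)) :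
    levyExponent ν ξ ≤ 2 * truncatedSecondMoment ν ‖ξ‖ := by
  rw [levyExponent, truncatedSecondMoment, ← integral_const_mul]
  refine integral_mono (h.integrable_one_sub_cos ξ) ((h.integrable_min_sq _).const_mul 2)
    fun x => (one_sub_cos_le_two_mul_min _).trans ?_
  have : (inner ℝ ξ x) ^ 2 ≤ (‖ξ‖ * ‖x‖) ^ 2 := sq_le_sq' (neg_le_of_abs_le
    (abs_real_inner_le_norm ξ x)) (real_inner_le_norm ξ x)
  show 2 * min 1 ((inner ℝ ξ x) ^ 2) ≤ 2 * min 1 ((‖ξ‖ * ‖x‖) ^ 2)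
  gcongr

theorem IsLevyMeasure.truncatedSecondMoment_mono (h : IsLevyMeasure ν) {u v : ℝ}
    (hu : 0 ≤ u) (huv : u ≤ v) : truncatedSecondMoment ν u ≤ truncatedSecondMoment ν v :=
  integral_mono (h.integrable_min_sq u) (h.integrable_min_sq v) fun x => by
    show min 1 ((u * ‖x‖) ^ 2) ≤ min 1 ((v * ‖x‖) ^ 2)
    gcongr

theorem truncatedSecondMoment_nonneg (ν : Measure (EuclideanSpace ℝ (Fin d))) (u : ℝ) :
    0 ≤ truncatedSecondMoment ν u :=
  integral_nonneg fun _ => by positivity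

theorem IsLevyMeasure.integrable_indicator_norm_gt (h : IsLevyMeasure ν) {r : ℝ} (hr : 0 < r) :
    Integrable ({x : EuclideanSpace ℝ (Fin d) | r < ‖x‖}.indicator (1 : EuclideanSpace ℝ (Fin d) → ℝ)) ν := by
  have hm : MeasurableSet {x : EuclideanSpace ℝ (Fin d) | r < ‖x‖} :=
    measurableSet_lt measurable_const measurable_norm
  refine (h.integrable_min_sq r⁻¹).mono' (by measurability) (ae_of_all _ fun x => ?_)
  by_cases hx : r < ‖x‖
  · have h1 : 1 ≤ (r⁻¹ * ‖x‖) ^ 2 := by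
      apply one_le_pow₀
      rw [inv_mul_eq_div, one_le_div hr]; exact hx.le
    simp [Set.indicator, hx, h1]
  · simp only [Set.indicator, Set.mem_ofPred_eq, hx, if_false, norm_zero]
    positivity

theorem IsLevyMeasure.measure_norm_gt_lt_top (h : IsLevyMeasure ν) {r : ℝ} (hr : 0 < r) :
    ν {x | r < ‖x‖} < ⊤ := by
  have hm : MeasurableSet {x : EuclideanSpace ℝ (Fin d) | r < ‖x‖} :=
    measurableSet_lt measurable_const measurable_norm
  have := (integrable_indicator_iff hm).1 (h.integrable_indicator_norm_gt hr)
  simpa [Pi.one_def, integrableOn_const_iff] using this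

/-- Markov's inequality for the tail of a Lévy measure. -/
theorem IsLevyMeasure.measureReal_norm_gt_le (h : IsLevyMeasure ν) {r : ℝ} (hr : 0 < r) :
    ν.real {x | r < ‖x‖} ≤ truncatedSecondMoment ν (1 / r) := by
  have hm : MeasurableSet {x : EuclideanSpace ℝ (Fin d) | r < ‖x‖} :=
    measurableSet_lt measurable_const measurable_norm
  rw [← integral_indicator_one hm]
  refine integral_mono (h.integrable_indicator_norm_gt hr) (h.integrable_min_sq _) fun x => ?_
  by_cases hx : r < ‖x‖
  · have h1 : 1 ≤ (1 / r * ‖x‖) ^ 2 := by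
      apply one_le_pow₀
      rw [one_div, inv_mul_eq_div, one_le_div hr]; exact hx.le
    simp only [Set.indicator, Set.mem_ofPred_eq, hx, if_true, min_eq_left h1]
    simp
  · simp only [Set.indicator, Set.mem_ofPred_eq, hx, if_false]
    positivity

/-- The growth of the truncated second moment controls the tail from below. -/
theorem IsLevyMeasure.truncatedSecondMoment_le_add_tail (h : IsLevyMeasure ν) {r a : ℝ}
    (hr : 0 < r) (ha : 1 ≤ a) :
    truncatedSecondMoment ν (1 / (a * r)) ≤
      truncatedSecondMoment ν (1 / r) / a ^ 2 + ν.real {x | r < ‖x‖} := by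
  have hm : MeasurableSet {x : EuclideanSpace ℝ (Fin d) | r < ‖x‖} :=
    measurableSet_lt measurable_const measurable_norm
  have ha0 : 0 < a := by linarith
  rw [← integral_indicator_one hm, truncatedSecondMoment, truncatedSecondMoment,
    ← integral_div, ← integral_add ((h.integrable_min_sq _).div_const _)
      (h.integrable_indicator_norm_gt hr)]
  refine integral_mono (h.integrable_min_sq _) (((h.integrable_min_sq _).div_const _).add
    (h.integrable_indicator_norm_gt hr)) fun x => ?_
  by_cases hx : r < ‖x‖
  · simp only [Set.indicator, Set.mem_ofPred_eq, hx, if_true, Pi.one_apply]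
    refine (min_le_left _ _).trans (le_add_of_nonneg_left (by positivity))
  -- Inside the ball the truncation at scale `r` is inactive, so passing to scale `a * r` gains
  -- exactly `1 / a ^ 2`.
  · have h1 : (1 / r * ‖x‖) ^ 2 ≤ 1 := by
      apply pow_le_one₀ (by positivity)
      rw [one_div, inv_mul_eq_div, div_le_one hr]; exact not_lt.1 hx
    simp only [Set.indicator, Set.mem_ofPred_eq, hx, if_false, add_zero, min_eq_right h1]
    refine (min_le_right _ _).trans (le_of_eq ?_)
    field_simp

end LevyMeasure

/-! ### Consequences of unimodality -/

section Unimodal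

variable {d : ℕ} {ν : Measure (EuclideanSpace ℝ (Fin d))} {f : EuclideanSpace ℝ (Fin d) → ℝ}

/-- Half-space tails are controlled by the exponent: shifting by half a period of
`cos ⟨ξ, ·⟩` away from the origin decreases the density. -/
theorem IsUnimodalLevyMeasure.measure_pi_lt_inner_le (h : IsUnimodalLevyMeasure ν f)
    (ξ : EuclideanSpace ℝ (Fin d)) :
    ν {x | Real.pi < inner ℝ ξ x} ≤ ∫⁻ x, ENNReal.ofReal (1 - Real.cos (inner ℝ ξ x)) ∂ν := by
  rcases eq_or_ne ξ 0 with rfl | hξ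
  · simp [not_lt.2 Real.pi_pos.le]
  have hξ2 : 0 < ‖ξ‖ ^ 2 := by positivity
  -- Translation by `v` raises `⟨ξ, ·⟩` by `π`: it carries `P` onto `Q` and flips the sign of the
  -- cosine.
  set v : EuclideanSpace ℝ (Fin d) := (Real.pi / ‖ξ‖ ^ 2) • ξ with hv
  have hξv : inner ℝ ξ v = Real.pi := by
    rw [hv, inner_smul_right, real_inner_self_eq_norm_sq]; field_simp
  set G : EuclideanSpace ℝ (Fin d) → ENNReal :=
    fun x => ENNReal.ofReal (1 - Real.cos (inner ℝ ξ x)) with hG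
  set F : EuclideanSpace ℝ (Fin d) → ENNReal := fun x => ENNReal.ofReal (f x) with hF
  have hGm : Measurable G := by fun_prop
  have hFm : Measurable F := h.radial.measurable.ennreal_ofReal
  set P : Set (EuclideanSpace ℝ (Fin d)) := {x | 0 < inner ℝ ξ x} with hP
  set Q : Set (EuclideanSpace ℝ (Fin d)) := {x | Real.pi < inner ℝ ξ x} with hQ
  have hPm : MeasurableSet P := measurableSet_lt measurable_const (by fun_prop)
  have hQm : MeasurableSet Q := measurableSet_lt measurable_const (by fun_prop)
  have hQP : Q ⊆ P := fun x hx => Real.pi_pos.trans hx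
  have hshift : ∀ x ∈ P, F (x + v) ≤ F x := by
    intro x hx
    have hx' : 0 < inner ℝ ξ x := hx
    refine ENNReal.ofReal_le_ofReal (h.radial.le_of_norm_le _ _ ?_ ?_)
    · rintro rfl; simp at hx'
    · have h1 : 0 ≤ inner ℝ x v := by
        rw [hv, inner_smul_right, real_inner_comm]
        have := Real.pi_pos
        positivity
      have h2 := norm_add_sq_real x v
      refine le_of_sq_le_sq ?_ (norm_nonneg _)
      nlinarith [sq_nonneg ‖v‖]
  have h1 : ∫⁻ x in Q, G (x - v) * F x ≤ ∫⁻ x in P, G x * F x := by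
    rw [← lintegral_indicator hQm, ← lintegral_indicator hPm]
    rw [← lintegral_add_right_eq_self _ v]
    refine lintegral_mono fun x => ?_
    by_cases hx : x ∈ P
    · have hx' : x + v ∈ Q := by
        have : 0 < inner ℝ ξ x := hx
        simp only [hQ, Set.mem_ofPred_eq, inner_add_right, hξv]; linarith
      rw [Set.indicator_of_mem hx, Set.indicator_of_mem hx', add_sub_cancel_right]
      gcongr
      exact hshift x hx
    · have hx' : x + v ∉ Q := by
        intro hc
        apply hx
        simp only [hQ, Set.mem_ofPred_eq, inner_add_right, hξv] at hc
        simp only [hP, Set.mem_ofPred_eq]; linarith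
      rw [Set.indicator_of_notMem hx']; exact zero_le
  have h2 : ∫⁻ x in Q, G x * F x ≤ ∫⁻ x in P, G x * F x := lintegral_mono_set hQP
  -- Since `1 + cos` and `1 - cos` add up to 2, averaging the bounds `h1` and `h2` removes the
  -- oscillation.
  have hsum : ∀ x, G (x - v) + G x = 2 := by
    intro x
    have h3 : Real.cos (inner ℝ ξ (x - v)) = - Real.cos (inner ℝ ξ x) := by
      rw [inner_sub_right, hξv, Real.cos_sub_pi]
    simp only [hG, h3]
    rw [← ENNReal.ofReal_add (by linarith [Real.neg_one_le_cos (inner ℝ ξ x)])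
      (by linarith [Real.cos_le_one (inner ℝ ξ x)])]
    ring_nf
    simp
  have h4 : ∫⁻ x in Q, (2 : ENNReal) * F x ≤ 2 * ∫⁻ x in P, G x * F x := by
    have : ∫⁻ x in Q, (2 : ENNReal) * F x
        = (∫⁻ x in Q, G (x - v) * F x) + ∫⁻ x in Q, G x * F x := by
      rw [← lintegral_add_right _ (by fun_prop)]
      refine lintegral_congr fun x => ?_
      rw [← add_mul, hsum x]
    rw [this, two_mul]
    exact add_le_add h1 h2
  rw [lintegral_const_mul _ hFm] at h4
  have h5 : ∫⁻ x in Q, F x ≤ ∫⁻ x in P, G x * F x :=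
    (ENNReal.mul_le_mul_iff_right two_ne_zero ENNReal.ofNat_ne_top).1 h4
  rw [h.eq_withDensity, withDensity_apply _ hQm, lintegral_withDensity_eq_lintegral_mul _ hFm hGm]
  refine h5.trans ((setLIntegral_le_lintegral _ _).trans (le_of_eq ?_))
  refine lintegral_congr fun x => ?_
  simp [mul_comm]

theorem IsUnimodalLevyMeasure.measure_pi_lt_inner_le_levyExponent
    (h : IsUnimodalLevyMeasure ν f) (ξ : EuclideanSpace ℝ (Fin d)) :
    ν {x | Real.pi < inner ℝ ξ x} ≤ ENNReal.ofReal (levyExponent ν ξ) := by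
  rw [levyExponent, ofReal_integral_eq_lintegral_ofReal (h.isLevyMeasure.integrable_one_sub_cos ξ)
    (ae_of_all _ fun x => by simpa using Real.cos_le_one _)]
  exact h.measure_pi_lt_inner_le ξ

theorem levyExponent_neg (ν : Measure (EuclideanSpace ℝ (Fin d)))
    (ξ : EuclideanSpace ℝ (Fin d)) : levyExponent ν (-ξ) = levyExponent ν ξ := by
  simp [levyExponent, inner_neg_left]

theorem levyExponent_nonneg (ν : Measure (EuclideanSpace ℝ (Fin d)))
    (ξ : EuclideanSpace ℝ (Fin d)) : 0 ≤ levyExponent ν ξ :=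
  integral_nonneg fun x => by simpa using Real.cos_le_one _

/-- Where `|⟨ξ, x⟩| ≤ π` the quadratic bound on the cosine costs `π² / 2`; the rest is two opposite
half-spaces, each of mass at most `ψ(ξ)`, whence the `+ 2`. -/
theorem IsUnimodalLevyMeasure.lintegral_min_inner_sq_le (h : IsUnimodalLevyMeasure ν f)
    (ξ : EuclideanSpace ℝ (Fin d)) :
    ∫⁻ x, ENNReal.ofReal (min 1 ((inner ℝ ξ x) ^ 2)) ∂ν ≤
      ENNReal.ofReal ((Real.pi ^ 2 / 2 + 2) * levyExponent ν ξ) := by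
  have hQm : ∀ η : EuclideanSpace ℝ (Fin d), MeasurableSet {x | Real.pi < inner ℝ η x} :=
    fun η => measurableSet_lt measurable_const (by fun_prop)
  have hψ := levyExponent_nonneg ν ξ
  calc ∫⁻ x, ENNReal.ofReal (min 1 ((inner ℝ ξ x) ^ 2)) ∂ν
      ≤ ∫⁻ x, (ENNReal.ofReal (Real.pi ^ 2 / 2 * (1 - Real.cos (inner ℝ ξ x)))
          + {x | Real.pi < inner ℝ ξ x}.indicator 1 x
          + {x | Real.pi < inner ℝ (-ξ) x}.indicator 1 x) ∂ν := by
        refine lintegral_mono fun x => ?_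
        have hle1 : ENNReal.ofReal (min 1 ((inner ℝ ξ x) ^ 2)) ≤ 1 := by
          simp
        rcases le_or_gt |inner ℝ ξ x| Real.pi with hx | hx
        · exact (ENNReal.ofReal_le_ofReal (min_one_sq_le_one_sub_cos hx)).trans
            (by rw [add_assoc]; exact le_self_add)
        · rcases lt_abs.1 hx with hx | hx
          · have h1 : {x | Real.pi < inner ℝ ξ x}.indicator (1 : EuclideanSpace ℝ (Fin d) → ENNReal) x = 1 :=
              Set.indicator_of_mem (s := {x | Real.pi < inner ℝ ξ x}) hx _
            rw [h1]
            exact hle1.trans (le_add_right le_add_self)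
          · have h1 : {x | Real.pi < inner ℝ (-ξ) x}.indicator (1 : EuclideanSpace ℝ (Fin d) → ENNReal) x = 1 :=
              Set.indicator_of_mem (s := {x | Real.pi < inner ℝ (-ξ) x})
                (by simpa [inner_neg_left] using hx) _
            rw [h1]
            exact hle1.trans le_add_self
    _ = ENNReal.ofReal (Real.pi ^ 2 / 2 * levyExponent ν ξ)
          + ν {x | Real.pi < inner ℝ ξ x} + ν {x | Real.pi < inner ℝ (-ξ) x} := by
        rw [lintegral_add_right _ (measurable_one.indicator (hQm _)),
          lintegral_add_right _ (measurable_one.indicator (hQm _)),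
          lintegral_indicator_one (hQm _), lintegral_indicator_one (hQm _), levyExponent,
          ← integral_const_mul, ofReal_integral_eq_lintegral_ofReal
            ((h.isLevyMeasure.integrable_one_sub_cos ξ).const_mul _)]
        refine ae_of_all _ fun x => ?_
        have := Real.cos_le_one (inner ℝ ξ x)
        exact mul_nonneg (by positivity) (by linarith)
    _ ≤ ENNReal.ofReal (Real.pi ^ 2 / 2 * levyExponent ν ξ)
          + ENNReal.ofReal (levyExponent ν ξ) + ENNReal.ofReal (levyExponent ν ξ) := by
        gcongr
        · exact h.measure_pi_lt_inner_le_levyExponent ξ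
        · rw [← levyExponent_neg ν ξ]
          exact h.measure_pi_lt_inner_le_levyExponent (-ξ)
    _ = ENNReal.ofReal ((Real.pi ^ 2 / 2 + 2) * levyExponent ν ξ) := by
        rw [← ENNReal.ofReal_add (by positivity) hψ, ← ENNReal.ofReal_add (by positivity) hψ]
        ring_nf

/-- This subadditivity reduces the truncated `‖x‖²` to its coordinates, at the price of a factor
`d`. -/
theorem min_one_sum_le {ι : Type*} (s : Finset ι) (a : ι → ℝ) (ha : ∀ i, 0 ≤ a i) :
    min 1 (∑ i ∈ s, a i) ≤ ∑ i ∈ s, min 1 (a i) := by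
  by_cases hs : ∃ i ∈ s, 1 ≤ a i
  · obtain ⟨i, hi, h1⟩ := hs
    refine (min_le_left _ _).trans ?_
    refine (min_eq_left h1).ge.trans ?_
    exact Finset.single_le_sum (f := fun i => min 1 (a i))
      (fun j _ => le_min zero_le_one (ha j)) hi
  · push Not at hs
    exact (min_le_right _ _).trans
      (Finset.sum_le_sum fun i hi => (min_eq_right (hs i hi).le).ge)

/-- For isotropic unimodal Lévy measures the exponent dominates the truncated second moment. -/
theorem IsUnimodalLevyMeasure.truncatedSecondMoment_le [NeZero d]
    (h : IsUnimodalLevyMeasure ν f) {u : ℝ} (hu : 0 ≤ u) :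
    truncatedSecondMoment ν u ≤ d * (Real.pi ^ 2 / 2 + 2) * radialExponent ν u := by
  have hψ : 0 ≤ radialExponent ν u := levyExponent_nonneg _ _
  have hcoord : ∀ i : Fin d,
      levyExponent ν (EuclideanSpace.single i u) = radialExponent ν u := by
    intro i
    rw [levyExponent_eq_radialExponent h]
    simp [abs_of_nonneg hu]
  rw [truncatedSecondMoment, integral_eq_lintegral_of_nonneg_ae
    (ae_of_all _ fun x => by positivity) (h.isLevyMeasure.integrable_min_sq u).1]
  refine ENNReal.toReal_le_of_le_ofReal (by positivity) ?_
  calc ∫⁻ x, ENNReal.ofReal (min 1 ((u * ‖x‖) ^ 2)) ∂ν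
      ≤ ∫⁻ x, ∑ i : Fin d,
          ENNReal.ofReal (min 1 ((inner ℝ (EuclideanSpace.single i u) x) ^ 2)) ∂ν := by
        refine lintegral_mono fun x => ?_
        rw [← ENNReal.ofReal_sum_of_nonneg fun i _ => by positivity]
        refine ENNReal.ofReal_le_ofReal ?_
        refine le_trans (le_of_eq ?_) (min_one_sum_le _ _ fun i => sq_nonneg _)
        rw [mul_pow, EuclideanSpace.real_norm_sq_eq, Finset.mul_sum]
        congr 1
        refine Finset.sum_congr rfl fun i _ => ?_
        simp [EuclideanSpace.inner_single_left, mul_pow]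
    _ = ∑ i : Fin d, ∫⁻ x,
          ENNReal.ofReal (min 1 ((inner ℝ (EuclideanSpace.single i u) x) ^ 2)) ∂ν :=
        lintegral_finsetSum _ fun i _ => by fun_prop
    _ ≤ ∑ _i : Fin d, ENNReal.ofReal ((Real.pi ^ 2 / 2 + 2) * radialExponent ν u) := by
        refine Finset.sum_le_sum fun i _ => ?_
        rw [← hcoord i]
        exact h.lintegral_min_inner_sq_le _
    _ = ENNReal.ofReal (d * (Real.pi ^ 2 / 2 + 2) * radialExponent ν u) := by
        rw [Finset.sum_const, Finset.card_univ, Fintype.card_fin, nsmul_eq_mul, mul_assoc,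
          ENNReal.ofReal_mul (Nat.cast_nonneg d), ENNReal.ofReal_natCast]

theorem IsUnimodalLevyMeasure.radialExponent_le [NeZero d]
    (h : IsUnimodalLevyMeasure ν f) {u : ℝ} (hu : 0 ≤ u) :
    radialExponent ν u ≤ 2 * truncatedSecondMoment ν u := by
  have := h.isLevyMeasure.levyExponent_le (EuclideanSpace.single (0 : Fin d) u)
  simpa [radialExponent, abs_of_nonneg hu] using this

/-- The exponent need not be monotone, but its majorant `2H` is, so the supremum costs nothing more.
-/
theorem IsUnimodalLevyMeasure.maximalFunction_radialExponent_le [NeZero d]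
    (h : IsUnimodalLevyMeasure ν f) {u : ℝ} (hu : 0 ≤ u) :
    maximalFunction (radialExponent ν) u ≤ 2 * truncatedSecondMoment ν u := by
  refine csSup_le ((Set.nonempty_Icc.2 hu).image _) ?_
  rintro _ ⟨s, hs, rfl⟩
  refine (h.radialExponent_le hs.1).trans ?_
  have := h.isLevyMeasure.truncatedSecondMoment_mono hs.1 hs.2
  linarith

/-- The mass of an annulus is at most its inner density times the volume of the outer ball. -/
theorem IsUnimodalLevyMeasure.tail_sub_tail_le
    (h : IsUnimodalLevyMeasure ν f) {x : EuclideanSpace ℝ (Fin d)} (hx : x ≠ 0) {R : ℝ}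
    (hR : ‖x‖ ≤ R) :
    ν.real {y | ‖x‖ < ‖y‖} ≤ ν.real {y | R < ‖y‖} +
      f x * (R ^ d * volume.real (Metric.ball (0 : EuclideanSpace ℝ (Fin d)) 1)) := by
  have hx0 : 0 < ‖x‖ := norm_pos_iff.2 hx
  have hR0 : 0 < R := hx0.trans_le hR
  have hmeas : ∀ r : ℝ, MeasurableSet {y : EuclideanSpace ℝ (Fin d) | r < ‖y‖} :=
    fun r => measurableSet_lt measurable_const measurable_norm
  have hfx := h.radial.nonneg x hx
  have hT := (h.isLevyMeasure.measure_norm_gt_lt_top hR0).ne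
  have hann : ν ({y | ‖x‖ < ‖y‖} \ {y | R < ‖y‖}) ≤
      ENNReal.ofReal (f x * (R ^ d *
        volume.real (Metric.ball (0 : EuclideanSpace ℝ (Fin d)) 1))) := by
    have hsub : {y : EuclideanSpace ℝ (Fin d) | ‖x‖ < ‖y‖} \ {y | R < ‖y‖} ⊆
        Metric.closedBall 0 R := by
      rintro y ⟨_, hy⟩
      simpa using hy
    rw [h.eq_withDensity, withDensity_apply _ ((hmeas _).diff (hmeas _))]
    calc ∫⁻ y in {y | ‖x‖ < ‖y‖} \ {y | R < ‖y‖}, ENNReal.ofReal (f y)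
        ≤ ∫⁻ _ in {y | ‖x‖ < ‖y‖} \ {y | R < ‖y‖}, ENNReal.ofReal (f x) :=
          setLIntegral_mono measurable_const fun y hy =>
            ENNReal.ofReal_le_ofReal (h.radial.le_of_norm_le x y hx (le_of_lt hy.1))
      _ ≤ ENNReal.ofReal (f x) * volume (Metric.closedBall (0 : EuclideanSpace ℝ (Fin d)) R) := by
          rw [setLIntegral_const]
          gcongr
      _ = _ := by
          rw [Measure.addHaar_closedBall _ _ hR0.le, ENNReal.ofReal_mul hfx,
            ENNReal.ofReal_mul (by positivity), finrank_euclideanSpace_fin, Measure.real,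
            ENNReal.ofReal_toReal measure_ball_lt_top.ne]
  have hsplit : ν {y | ‖x‖ < ‖y‖} ≤ ν {y | R < ‖y‖} +
      ν ({y | ‖x‖ < ‖y‖} \ {y | R < ‖y‖}) := by
    refine (measure_mono ?_).trans (measure_union_le _ _)
    rw [Set.union_sdiff_self]
    exact Set.subset_union_right
  refine ENNReal.toReal_le_of_le_ofReal (by positivity) (hsplit.trans ?_)
  rw [ENNReal.ofReal_add measureReal_nonneg (by positivity), Measure.real,
    ENNReal.ofReal_toReal hT]
  gcongr

end Unimodal

/-! ### Scaling and the lower bound for the density -/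

theorem exists_one_le_mul_rpow_neg_le {a K ε : ℝ} (ha : 0 < a) (hε : 0 < ε) :
    ∃ A : ℝ, 1 ≤ A ∧ K * A ^ (-a) ≤ ε := by
  have h := ((tendsto_rpow_neg_atTop ha).const_mul K)
  rw [mul_zero] at h
  obtain ⟨A, h1, h2⟩ :=
    ((h.eventually (ge_mem_nhds hε)).and (Filter.eventually_ge_atTop 1)).exists
  exact ⟨A, h2, h1⟩

theorem mainTheorem9 (d : ℕ) [NeZero d] (α₁ α₂ c₁ C₂ : ℝ)
    (hα₁ : 0 < α₁ ∧ α₁ < 2) (hα₂ : 0 < α₂ ∧ α₂ < 2)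
    (hc₁ : 0 < c₁ ∧ c₁ ≤ 1) (hC₂ : 1 ≤ C₂) :
    ∃ c r₀ : ℝ, 0 < c ∧ 0 < r₀ ∧
      ∀ (ν : Measure (EuclideanSpace ℝ (Fin d))) (f : EuclideanSpace ℝ (Fin d) → ℝ) (θ : ℝ),
        IsUnimodalLevyMeasure ν f → ν ≠ 0 → 0 ≤ θ →
        WLSC (radialExponent ν) α₁ θ c₁ →
        WUSC (radialExponent ν) α₂ θ C₂ →
        ∀ x : EuclideanSpace ℝ (Fin d), x ≠ 0 → θ * ‖x‖ < r₀ →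
          c * (maximalFunction (radialExponent ν) (1 / ‖x‖) / ‖x‖ ^ d) ≤ f x := by
  set M : ℝ := d * (Real.pi ^ 2 / 2 + 2) with hM
  have hd : (0 : ℝ) < d := Nat.cast_pos.2 (NeZero.pos d)
  have hM0 : 0 < M := by positivity
  -- `A` absorbs the constants lost in `hup`, and `B` below those in `hlow`; the gap between 1/2 and
  -- 1/4 is what leaves mass in the annulus.
  obtain ⟨A, hA, hA'⟩ := exists_one_le_mul_rpow_neg_le (a := 2 - α₂) (K := 2 * M * C₂)
    (ε := 1 / 2) (by linarith) (by norm_num)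
  obtain ⟨B, hB, hB'⟩ := exists_one_le_mul_rpow_neg_le (a := α₁) (K := 2 * M / c₁)
    (ε := 1 / 4) hα₁.1 (by norm_num)
  have hA0 : 0 < A := by linarith
  have hB0 : 0 < B := by linarith
  set V : ℝ := volume.real (Metric.ball (0 : EuclideanSpace ℝ (Fin d)) 1) with hV
  have hV0 : 0 < V := ENNReal.toReal_pos (Metric.measure_ball_pos _ _ one_pos).ne'
    measure_ball_lt_top.ne
  -- The radius `1 / (A * B)` keeps the lowest frequency used, `1 / (A * B * s)`, above `θ`.
  refine ⟨1 / (4 * A ^ 2 * (A * B) ^ d * V), 1 / (A * B), by positivity, by positivity, ?_⟩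
  intro ν f θ h _ hθ hL hU x hx hxθ
  have hs : 0 < ‖x‖ := norm_pos_iff.2 hx
  set s := ‖x‖ with hsdef
  set H := truncatedSecondMoment ν with hH
  have hH0 : ∀ u, 0 ≤ H u := truncatedSecondMoment_nonneg ν
  have hθ0 : θ < 1 / (A * B * s) := by
    rw [lt_div_iff₀ (by positivity)] at hxθ ⊢
    linarith
  have hBu : B * (1 / (A * B * s)) = 1 / (A * s) := by field_simp
  have hAu : A * (1 / (A * s)) = 1 / s := by field_simp
  have hθ1 : θ < 1 / (A * s) := by
    rw [← hBu]
    exact hθ0.trans_le (le_mul_of_one_le_left (by positivity) hB)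
  have hup : H (1 / s) / A ^ 2 ≤ 1 / 2 * H (1 / (A * s)) := by
    have h1 : H (1 / s) ≤ 2 * M * C₂ * A ^ α₂ * H (1 / (A * s)) := by
      have e1 : H (1 / s) ≤ M * radialExponent ν (1 / s) :=
        h.truncatedSecondMoment_le (by positivity)
      have e2 := hU.scaling A _ hA hθ1
      rw [hAu] at e2
      have e3 : radialExponent ν (1 / (A * s)) ≤ 2 * H (1 / (A * s)) :=
        h.radialExponent_le (by positivity)
      calc H (1 / s) ≤ M * (C₂ * A ^ α₂ * (2 * H (1 / (A * s)))) := by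
            refine e1.trans (mul_le_mul_of_nonneg_left (e2.trans ?_) hM0.le)
            gcongr
        _ = _ := by ring
    have h2 : A ^ α₂ = A ^ 2 * A ^ (-(2 - α₂)) := by
      rw [← Real.rpow_natCast A 2, ← Real.rpow_add hA0]
      norm_num
    rw [div_le_iff₀ (by positivity)]
    calc H (1 / s) ≤ 2 * M * C₂ * A ^ α₂ * H (1 / (A * s)) := h1
      _ = (2 * M * C₂ * A ^ (-(2 - α₂))) * (H (1 / (A * s)) * A ^ 2) := by rw [h2]; ring
      _ ≤ 1 / 2 * (H (1 / (A * s)) * A ^ 2) :=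
          mul_le_mul_of_nonneg_right hA' (mul_nonneg (hH0 _) (by positivity))
      _ = _ := by ring
  have hlow : H (1 / (A * B * s)) ≤ 1 / 4 * H (1 / (A * s)) := by
    have e1 : H (1 / (A * B * s)) ≤ M * radialExponent ν (1 / (A * B * s)) :=
      h.truncatedSecondMoment_le (by positivity)
    have e2 := hL.scaling B _ hB hθ0
    rw [hBu] at e2
    have e3 : radialExponent ν (1 / (A * s)) ≤ 2 * H (1 / (A * s)) :=
      h.radialExponent_le (by positivity)
    have hBα : 0 < B ^ α₁ := Real.rpow_pos_of_pos hB0 _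
    have e4 : radialExponent ν (1 / (A * B * s)) ≤ 2 * H (1 / (A * s)) / (c₁ * B ^ α₁) := by
      rw [le_div_iff₀ (mul_pos hc₁.1 hBα)]
      linarith
    calc H (1 / (A * B * s)) ≤ M * (2 * H (1 / (A * s)) / (c₁ * B ^ α₁)) :=
          e1.trans (mul_le_mul_of_nonneg_left e4 hM0.le)
      _ = 2 * M / c₁ * B ^ (-α₁) * H (1 / (A * s)) := by
          rw [Real.rpow_neg hB0.le]
          have := hc₁.1.ne'
          field_simp
      _ ≤ _ := mul_le_mul_of_nonneg_right hB' (hH0 _)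
  have htail := h.isLevyMeasure.truncatedSecondMoment_le_add_tail hs hA
  have htail' := h.isLevyMeasure.measureReal_norm_gt_le (r := A * B * s) (by positivity)
  have hABs : s ≤ A * B * s :=
    le_mul_of_one_le_left hs.le (one_le_mul_of_one_le_of_one_le hA hB)
  have hann := h.tail_sub_tail_le hx hABs
  have hmax : maximalFunction (radialExponent ν) (1 / s) ≤ 2 * H (1 / s) :=
    h.maximalFunction_radialExponent_le (by positivity)
  -- The tail beyond `s` is at least `H/2` and that beyond `A * B * s` at most `H/4`, with `H` taken
  -- at `1 / (A * s)`.
  have hkey : 1 / 4 * H (1 / (A * s)) ≤ f x * ((A * B * s) ^ d * V) := by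
    linarith
  rw [div_le_iff₀ (by positivity)] at hup
  -- `hup` is used a second time, to return from frequency `1 / (A * s)` to `1 / s`.
  have hfin : maximalFunction (radialExponent ν) (1 / s) ≤
      4 * A ^ 2 * (f x * ((A * B * s) ^ d * V)) := by
    have := mul_le_mul_of_nonneg_left hkey (by positivity : 0 ≤ 4 * A ^ 2)
    linarith
  rw [one_div_mul_eq_div, div_div, div_le_iff₀ (by positivity)]
  refine hfin.trans (le_of_eq ?_)
  rw [mul_pow (A * B) s]
  ring
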